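/- An FL-algebra is a structure $X=(X,\sqcap,\sqcup,\backslash,\cdot,/,1,0)$ such that $(X,\sqcap,\sqcup)$ is a lattice with order $\sqsubseteq$, $(X,\cdot,1)$ is a monoid, $0\in X$ is arbitrary, and $a\cdot b\sqsubseteq c \iff b\sqsubseteq a\backslash c\iff a\sqsubseteq c/b$ for all $a,b,c$; put $a\Rightarrow b:=b/a$. It is commutative if $ab=ba$ for all $a,b$, and integral if $a\sqsubseteq 1$ for all $a$. Action expressions are $\alpha::=\mathrm a_n\mid\alpha\cup\alpha\mid\alpha;\alpha\mid\alpha^+$ ($n\in\mathbb N$), and formulas are $\varphi::=\mathrm p_n\mid\bar c\mid\varphi\wedge\varphi\mid\varphi\vee\varphi\mid\varphi\backslash\varphi\mid\varphi\cdot\varphi\mid\varphi/\varphi\mid[\alpha]\varphi$ ($n\in\mathbb N$, $c\in X$; the $\bar c$ are the canonical constants); $\varphi\to\psi:=\psi/\varphi$ and $\varphi\leftrightarrow\psi:=(\varphi\to\psi)\wedge(\psi\to\varphi)$. Let $X$ be finite. An $X$-frame is a non-empty set $S$ with functions $R_\alpha:S\times S\to X$, one for each action expression $\alpha$, such that for all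 $s,t\in S$: $R_{\alpha\cup\beta}(s,t)=R_\alpha(s,t)\sqcup R_\beta(s,t)$; $R_{\alpha;\beta}(s,t)=\bigsqcup_{x\in S}R_\alpha(s,x)\cdot R_\beta(x,t)$; and $R_{\alpha^+}(s,t)$ is the join, over all finite sequences $(u_1,\dots,u_n)$ in $S$ with $n\ge 0$, of $R_\alpha(s,u_1)\cdot R_\alpha(u_1,u_2)\cdots R_\alpha(u_n,t)$ (which is $R_\alpha(s,t)$ if $n=0$). A model based on the frame is a function $V$ assigning to each formula and each state an element of $X$ such that $V(\bar c,s)=c$, $V(\cdot,s)$ sends the connectives $\wedge,\vee,\backslash,\cdot,/$ to the operations $\sqcap,\sqcup,\backslash,\cdot,/$ of $X$, and $V([\alpha]\varphi,s)=\bigsqcap_{t\in S}(R_\alpha(s,t)\Rightarrow V(\varphi,t))$. A formula $\varphi$ is valid in all $X$-frames if $1\sqsubseteq V(\varphi,s)$ for every state $s$ of every model based on any $X$-frame. A non-modal homomorphism is a map $h$ from formulas to $X$ with $h(\bar c)=c$ that commutes with $\wedge,\vee,\backslash,\cdot,/$ (the values $h(\mathrm p_n)$ and $h([\alpha]\varphi)$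 are arbitrary). A Hilbert system consists of a set of axioms (formulas) and a set of rules (pairs of a finite set of premises and a conclusion); derivability of a formula from a set of formulas is defined as usual, and a theorem is a formula derivable from the empty set. A Hilbert system $\mathsf{Log}(X)$ in this language is a strongly complete presentation of $X$ if, for every set of formulas $\Gamma$ and every formula $\varphi$: $\varphi$ is derivable from $\Gamma$ in $\mathsf{Log}(X)$ iff every non-modal homomorphism $h$ with $1\sqsubseteq h(\psi)$ for all $\psi\in\Gamma$ satisfies $1\sqsubseteq h(\varphi)$. Given such a presentation, $\mathsf{PDL}(X)$ is the Hilbert system obtained from $\mathsf{Log}(X)$ by adding, for all formulas $\varphi,\psi$, all action expressions $\alpha,\beta$ and all $c\in X$, the axioms - $[\alpha]\bar 1$, - $([\alpha]\varphi\wedge[\alpha]\psi)\to[\alpha](\varphi\wedge\psi)$, - $[\alpha](\bar c\to\varphi)\leftrightarrow(\bar c\to[\alpha]\varphi)$, - $[\alpha\cup\beta]\varphi\leftrightarrow([\alpha]\varphi\wedge[\beta]\varphi)$, - $[\alpha;\beta]\varphi\leftrightarrow[\alpha][\beta]\varphi$, - $[\alpha^+]\varphi\leftrightarrow[\alpha](\varphi\wedge[\alpha^+]\varphi)$,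 and the rules "from $\varphi\to\psi$ infer $[\alpha]\varphi\to[\alpha]\psi$" and "from $\varphi\to[\alpha]\varphi$ infer $\varphi\to[\alpha^+]\varphi$". Theorem. Let $X$ be a finite commutative integral FL-algebra and let $\mathsf{Log}(X)$ be any strongly complete Hilbert presentation of $X$. Then, for every formula $\varphi$, $\varphi$ is valid in all $X$-frames if and only if $\varphi$ is a theorem of $\mathsf{PDL}(X)$. -/

import Mathlib

universe u v

namespace FLPDL

/-- An FL-algebra (full Lambek algebra): a lattice and a monoid `(X, *, 1)` whose multiplication
is residuated by `ldiv a b = a \ b` and `rdiv a b = a / b`, with an arbitrary distinguished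
element `0`. -/
class FLAlgebra (X : Type u) extends Lattice X, Monoid X, Zero X where
  /-- The left residual `a \ b`. -/
  ldiv : X → X → X
  /-- The right residual `a / b`. -/
  rdiv : X → X → X
  mul_le_iff_le_ldiv : ∀ a b c : X, a * b ≤ c ↔ b ≤ ldiv a c
  mul_le_iff_le_rdiv : ∀ a b c : X, a * b ≤ c ↔ a ≤ rdiv c b

/-- The implication `a ⇒ b`, which is `b / a`. -/
def FLAlgebra.himp {X : Type u} [FLAlgebra X] (a b : X) : X := FLAlgebra.rdiv b a

section Bounds

variable {X : Type u} [FLAlgebra X] [Finite X]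

theorem exists_isLUB (A : Set X) : ∃ a, IsLUB A a := by
  classical
  let _ := Fintype.ofFinite X
  have _ : Nonempty X := ⟨1⟩
  let _ : BoundedOrder X := Fintype.toBoundedOrder X
  let _ : CompleteLattice X := Fintype.toCompleteLattice X
  exact ⟨sSup A, isLUB_sSup A⟩

theorem exists_isGLB (A : Set X) : ∃ a, IsGLB A a := by
  classical
  let _ := Fintype.ofFinite X
  have _ : Nonempty X := ⟨1⟩
  let _ : BoundedOrder X := Fintype.toBoundedOrder X
  let _ : CompleteLattice X := Fintype.toCompleteLattice X
  exact ⟨sInf A, isGLB_sInf A⟩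

/-- The join of an arbitrary family of elements of a finite FL-algebra. -/
noncomputable def bigJoin {ι : Type*} (f : ι → X) : X := (exists_isLUB (Set.range f)).choose

/-- The meet of an arbitrary family of elements of a finite FL-algebra. -/
noncomputable def bigMeet {ι : Type*} (f : ι → X) : X := (exists_isGLB (Set.range f)).choose

theorem isLUB_bigJoin {ι : Type*} (f : ι → X) : IsLUB (Set.range f) (bigJoin f) :=
  (exists_isLUB (Set.range f)).choose_spec

theorem isGLB_bigMeet {ι : Type*} (f : ι → X) : IsGLB (Set.range f) (bigMeet f) :=
  (exists_isGLB (Set.range f)).choose_spec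

end Bounds

section Relations

variable {X : Type u} [FLAlgebra X] [Finite X] {S : Type v}

/-- Union of `X`-valued binary relations. -/
def relUnion (R Q : S → S → X) : S → S → X := fun s t => R s t ⊔ Q s t

/-- Composition of `X`-valued binary relations. -/
noncomputable def relComp (R Q : S → S → X) : S → S → X :=
  fun s t => bigJoin fun x : S => R s x * Q x t

/-- The weight of the path from `s` to `t` through a finite sequence of intermediate states.
The sequence is listed in reverse order: `u :: π` is the sequence `π` extended by `u` at its
end. -/
def pathValue {X : Type u} [FLAlgebra X] {S : Type v} (R : S → S → X) (s : S) : List S → S → X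
  | [], t => R s t
  | u :: π, t => pathValue R s π u * R u t

/-- Transitive closure of an `X`-valued binary relation: the join over all finite sequences of
intermediate states. -/
noncomputable def relPlus (R : S → S → X) : S → S → X :=
  fun s t => bigJoin fun π : List S => pathValue R s π t

end Relations

/-- Action expressions over the countable set of atomic actions `a_0, a_1, …`. -/
inductive Act : Type
  | atom : ℕ → Act
  | choice : Act → Act → Act
  | comp : Act → Act → Act
  | plus : Act → Act

/-- Formulas over the propositional variables `p_0, p_1, …`, with a canonical constant for each
element of `X`. -/
inductive Formula (X : Type u) : Type u
  | var : ℕ → Formula X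
  | const : X → Formula X
  | and : Formula X → Formula X → Formula X
  | or : Formula X → Formula X → Formula X
  | ldiv : Formula X → Formula X → Formula X
  | mul : Formula X → Formula X → Formula X
  | rdiv : Formula X → Formula X → Formula X
  | box : Act → Formula X → Formula X

namespace Formula

/-- `φ → ψ` is `ψ / φ`. -/
def imp {X : Type u} (φ ψ : Formula X) : Formula X := rdiv ψ φ

/-- `φ ↔ ψ` is `(φ → ψ) ∧ (ψ → φ)`. -/
def iff {X : Type u} (φ ψ : Formula X) : Formula X := and (imp φ ψ) (imp ψ φ)

end Formula

/-- An `X`-valued frame. -/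
structure Frame (X : Type u) [FLAlgebra X] [Finite X] where
  /-- The set of states. -/
  S : Type v
  nonempty : Nonempty S
  /-- The accessibility relation of each action expression. -/
  R : Act → S → S → X
  R_choice : ∀ α β, R (Act.choice α β) = relUnion (R α) (R β)
  R_comp : ∀ α β, R (Act.comp α β) = relComp (R α) (R β)
  R_plus : ∀ α, R (Act.plus α) = relPlus (R α)

/-- A model based on the frame `F`. -/
structure Model {X : Type u} [FLAlgebra X] [Finite X] (F : Frame.{u, v} X) where
  /-- The value of each formula in each state. -/
  V : Formula X → F.S → X
  V_const : ∀ c s, V (Formula.const c) s = c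
  V_and : ∀ φ ψ s, V (Formula.and φ ψ) s = V φ s ⊓ V ψ s
  V_or : ∀ φ ψ s, V (Formula.or φ ψ) s = V φ s ⊔ V ψ s
  V_ldiv : ∀ φ ψ s, V (Formula.ldiv φ ψ) s = FLAlgebra.ldiv (V φ s) (V ψ s)
  V_mul : ∀ φ ψ s, V (Formula.mul φ ψ) s = V φ s * V ψ s
  V_rdiv : ∀ φ ψ s, V (Formula.rdiv φ ψ) s = FLAlgebra.rdiv (V φ s) (V ψ s)
  V_box : ∀ α φ s, V (Formula.box α φ) s = bigMeet fun t : F.S => FLAlgebra.himp (F.R α s t) (V φ t)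

/-- `φ` is valid in the model `M`. -/
def Model.Valid {X : Type u} [FLAlgebra X] [Finite X] {F : Frame.{u, v} X} (M : Model F)
    (φ : Formula X) : Prop :=
  ∀ s : F.S, 1 ≤ M.V φ s

/-- `φ` is valid in the frame `F`: it is valid in each model based on `F`. -/
def Frame.Valid {X : Type u} [FLAlgebra X] [Finite X] (F : Frame.{u, v} X)
    (φ : Formula X) : Prop :=
  ∀ M : Model F, M.Valid φ

/-- A Hilbert system in the language of `X`: a set of axiom instances, and a set of rule instances
`(Δ, φ)` with finitely many premises `Δ` and conclusion `φ`. -/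
structure HilbertSystem (X : Type u) where
  ax : Set (Formula X)
  rules : Set (Finset (Formula X) × Formula X)

namespace HilbertSystem

variable {X : Type u}

/-- `H.Derivable Γ φ`: there is a proof of `φ` from the assumptions `Γ` in `H`. -/
inductive Derivable (H : HilbertSystem X) (Γ : Set (Formula X)) : Formula X → Prop
  | hyp (φ : Formula X) : φ ∈ Γ → Derivable H Γ φ
  | ax (φ : Formula X) : φ ∈ H.ax → Derivable H Γ φ
  | rule (Δ : Finset (Formula X)) (φ : Formula X) : (Δ, φ) ∈ H.rules →
      (∀ ψ ∈ Δ, Derivable H Γ ψ) → Derivable H Γ φ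

/-- Theorems are the formulas derivable from no assumptions. -/
def IsTheorem (H : HilbertSystem X) (φ : Formula X) : Prop := H.Derivable ∅ φ

end HilbertSystem

/-- Non-modal homomorphisms from formulas to `X`: the values of variables and of formulas
`[α]φ` are arbitrary. -/
structure IsNonModalHom {X : Type u} [FLAlgebra X] (h : Formula X → X) : Prop where
  map_const : ∀ c, h (Formula.const c) = c
  map_and : ∀ φ ψ, h (Formula.and φ ψ) = h φ ⊓ h ψ
  map_or : ∀ φ ψ, h (Formula.or φ ψ) = h φ ⊔ h ψ
  map_ldiv : ∀ φ ψ, h (Formula.ldiv φ ψ) = FLAlgebra.ldiv (h φ) (h ψ)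
  map_mul : ∀ φ ψ, h (Formula.mul φ ψ) = h φ * h ψ
  map_rdiv : ∀ φ ψ, h (Formula.rdiv φ ψ) = FLAlgebra.rdiv (h φ) (h ψ)

/-- `H` is strongly complete with respect to `X`: derivability in `H` from arbitrary sets of
assumptions coincides with consequence over all non-modal homomorphisms to `X`. -/
def HilbertSystem.StronglyComplete {X : Type u} [FLAlgebra X] (H : HilbertSystem X) : Prop :=
  ∀ (Γ : Set (Formula X)) (φ : Formula X), H.Derivable Γ φ ↔
    ∀ h : Formula X → X, IsNonModalHom h → (∀ ψ ∈ Γ, 1 ≤ h ψ) → 1 ≤ h φ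

section PDL

open Formula

/-- The modal axioms of `PDL(X)`. -/
inductive PDLAx {X : Type u} [FLAlgebra X] : Formula X → Prop
  | one (α : Act) : PDLAx (box α (const 1))
  | reg (α : Act) (φ ψ : Formula X) :
      PDLAx (imp (and (box α φ) (box α ψ)) (box α (and φ ψ)))
  | const (α : Act) (c : X) (φ : Formula X) :
      PDLAx (iff (box α (imp (const c) φ)) (imp (const c) (box α φ)))
  | choice (α β : Act) (φ : Formula X) :
      PDLAx (iff (box (Act.choice α β) φ) (and (box α φ) (box β φ)))
  | comp (α β : Act) (φ : Formula X) :
      PDLAx (iff (box (Act.comp α β) φ) (box α (box β φ)))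
  | plus (α : Act) (φ : Formula X) :
      PDLAx (iff (box (Act.plus α) φ) (box α (and φ (box (Act.plus α) φ))))

/-- The modal rules of `PDL(X)`. -/
inductive PDLRule {X : Type u} : Finset (Formula X) × Formula X → Prop
  | mon (α : Act) (φ ψ : Formula X) :
      PDLRule ({imp φ ψ}, imp (box α φ) (box α ψ))
  | plus (α : Act) (φ : Formula X) :
      PDLRule ({imp φ (box α φ)}, imp φ (box (Act.plus α) φ))

/-- `PDL(X)`: the extension of the presentation `L` by the modal axioms and rules. -/
def PDL {X : Type u} [FLAlgebra X] (L : HilbertSystem X) : HilbertSystem X where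
  ax := L.ax ∪ {φ | PDLAx φ}
  rules := L.rules ∪ {r | PDLRule r}

end PDL

end FLPDL

/-!
Soundness is an induction on derivations: each `V(·, s)` is a non-modal homomorphism, so strong
completeness makes the axioms and rules of `Log(X)` valid, and the modal axioms and rules are
checked in `X`.

For completeness, call a non-modal homomorphism *canonical* if it sends every theorem of `PDL(X)`
above `1`. Strong completeness, applied to the set of all theorems, shows that a formula is a
theorem as soon as all canonical homomorphisms send it above `1` (`isTheorem_of_canonical`). The
canonical homomorphisms are filtered through a finite set `Φ` of formulas containing the given one
and closed under a many-valued Fischer–Ladner condition (`exists_flClosed`): a state is a class of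
homomorphisms that agree on `Φ`, and an atomic action `a` gets the largest relation compatible with
the values of the formulas `[a]ψ` in `Φ`, namely `R_a(w, t) = ⨅ (w([a]ψ) ⇒ t(ψ))`.

The truth lemma `eval_eq` needs two estimates for every action `α`. The bound
`w([α]φ) · R_α(w, t) ≤ t(φ)` for `[α]φ ∈ Φ` is an induction on `α` (`box_mul_rel_le`). The converse
`le_box_of_mul_rel_le` says that `c ≤ w([α]φ)` as soon as `c · R_α(w, t) ≤ t(φ)` for all canonical
`t`; the crucial case is `α⁺`, where the induction rule has to be applied to a formula `χ` whose
value at `t` is `R_{α⁺}(w, t)`. Not every function of the state is the value of a formula, since `X`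
need not have terms that tell its elements apart sharply. The relations nevertheless are:
`t ↦ R_a(w, t)` is defined by a finite meet of formulas `c̄ → ψ`, and the functions defined by formulas
are closed under multiplication by constants and under arbitrary pointwise joins, the space of
functions being finite (`definable_rel`).
-/

namespace FLPDL

/-! ### Arithmetic of finite FL-algebras -/

section Arithmetic

variable {X : Type u} [FLAlgebra X]

theorem le_rdiv_iff {a b c : X} : a ≤ FLAlgebra.rdiv c b ↔ a * b ≤ c :=
  (FLAlgebra.mul_le_iff_le_rdiv a b c).symm

theorem le_ldiv_iff {a b c : X} : b ≤ FLAlgebra.ldiv a c ↔ a * b ≤ c :=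
  (FLAlgebra.mul_le_iff_le_ldiv a b c).symm

theorem mul_mono_left {a b : X} (c : X) (hab : a ≤ b) : a * c ≤ b * c :=
  le_rdiv_iff.1 (hab.trans (le_rdiv_iff.2 le_rfl))

theorem mul_mono_right {a b : X} (c : X) (hab : a ≤ b) : c * a ≤ c * b :=
  le_ldiv_iff.1 (hab.trans (le_ldiv_iff.2 le_rfl))

theorem one_le_rdiv_iff {a b : X} : 1 ≤ FLAlgebra.rdiv b a ↔ a ≤ b := by
  rw [le_rdiv_iff, one_mul]

theorem mul_sup_le_iff {a b c d : X} : a * (b ⊔ c) ≤ d ↔ a * b ≤ d ∧ a * c ≤ d := by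
  simp only [← le_ldiv_iff, sup_le_iff]

variable {ι S : Type*}

theorem pathValue_append_singleton (R : S → S → X) (s u t : S) (π : List S) :
    pathValue R s (π ++ [u]) t = R s u * pathValue R u π t := by
  induction π generalizing t with
  | nil => rfl
  | cons x π ih => simp only [List.cons_append, pathValue, ih, mul_assoc]

variable [Finite X]

theorem le_bigJoin (f : ι → X) (i : ι) : f i ≤ bigJoin f :=
  (isLUB_bigJoin f).1 ⟨i, rfl⟩

theorem bigJoin_le_iff {f : ι → X} {a : X} : bigJoin f ≤ a ↔ ∀ i, f i ≤ a := by
  rw [isLUB_le_iff (isLUB_bigJoin f), mem_upperBounds, Set.forall_mem_range]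

theorem le_bigMeet_iff {f : ι → X} {a : X} : a ≤ bigMeet f ↔ ∀ i, a ≤ f i := by
  rw [le_isGLB_iff (isGLB_bigMeet f), mem_lowerBounds, Set.forall_mem_range]

theorem bigMeet_le (f : ι → X) (i : ι) : bigMeet f ≤ f i :=
  (isGLB_bigMeet f).1 ⟨i, rfl⟩

theorem mul_bigJoin_le_iff {f : ι → X} {a b : X} :
    a * bigJoin f ≤ b ↔ ∀ i, a * f i ≤ b := by
  simp only [← le_ldiv_iff, bigJoin_le_iff]

theorem le_bigMeet_himp_iff {a : X} {f g : ι → X} :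
    a ≤ bigMeet (fun i => FLAlgebra.himp (f i) (g i)) ↔ ∀ i, a * f i ≤ g i := by
  simp only [le_bigMeet_iff, FLAlgebra.himp, le_rdiv_iff]

theorem le_relPlus (R : S → S → X) (s t : S) : R s t ≤ relPlus R s t :=
  le_bigJoin (fun π => pathValue R s π t) []

theorem relPlus_mul_le (R : S → S → X) (s u t : S) :
    relPlus R s u * R u t ≤ relPlus R s t := by
  rw [← le_rdiv_iff]
  refine bigJoin_le_iff.2 fun π => le_rdiv_iff.2 ?_
  exact le_bigJoin (fun π => pathValue R s π t) (u :: π)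

theorem mul_relPlus_le (R : S → S → X) (s u t : S) :
    R s u * relPlus R u t ≤ relPlus R s t := by
  refine mul_bigJoin_le_iff.2 fun π => ?_
  rw [← pathValue_append_singleton]
  exact le_bigJoin (fun π => pathValue R s π t) (π ++ [u])

/-- Induction principle for the transitive closure: a valuation that grows along `R` grows along
`R⁺`. -/
theorem mul_relPlus_le_of_forall {R : S → S → X} {f : S → X}
    (hf : ∀ s t, f s * R s t ≤ f t) (s t : S) : f s * relPlus R s t ≤ f t := by
  refine mul_bigJoin_le_iff.2 fun π => ?_
  induction π generalizing t with
  | nil => exact hf s t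
  | cons u π ih =>
    simp only [pathValue, ← mul_assoc]
    exact (mul_mono_left _ (ih u)).trans (hf u t)

/-- Bounds on `R⁺` by decomposing a path at its first step. -/
theorem mul_relPlus_le_of_first_step {R : S → S → X} {a : X} {f : S → X} {s : S}
    (h₁ : ∀ t, a * R s t ≤ f t) (h₂ : ∀ u t, a * R s u * relPlus R u t ≤ f t) (t : S) :
    a * relPlus R s t ≤ f t := by
  refine mul_bigJoin_le_iff.2 fun π => ?_
  rcases List.eq_nil_or_concat π with rfl | ⟨π, u, rfl⟩
  · exact h₁ t
  · rw [List.concat_eq_append, pathValue_append_singleton, ← mul_assoc]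
    exact (mul_mono_right _ (le_bigJoin (fun π => pathValue R u π t) π)).trans (h₂ u t)

end Arithmetic

/-! ### Soundness -/

section Soundness

variable {X : Type u} [FLAlgebra X]

theorem IsNonModalHom.one_le_imp_iff {h : Formula X → X} (hh : IsNonModalHom h)
    {φ ψ : Formula X} : 1 ≤ h (φ.imp ψ) ↔ h φ ≤ h ψ := by
  rw [Formula.imp, hh.map_rdiv, one_le_rdiv_iff]

theorem IsNonModalHom.one_le_iff_iff {h : Formula X → X} (hh : IsNonModalHom h)
    {φ ψ : Formula X} : 1 ≤ h (φ.iff ψ) ↔ h φ = h ψ := by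
  rw [Formula.iff, hh.map_and, le_inf_iff, hh.one_le_imp_iff, hh.one_le_imp_iff, le_antisymm_iff]

variable [Finite X] {F : Frame.{u, v} X}

theorem Model.isNonModalHom (M : Model F) (s : F.S) : IsNonModalHom fun φ => M.V φ s where
  map_const c := M.V_const c s
  map_and φ ψ := M.V_and φ ψ s
  map_or φ ψ := M.V_or φ ψ s
  map_ldiv φ ψ := M.V_ldiv φ ψ s
  map_mul φ ψ := M.V_mul φ ψ s
  map_rdiv φ ψ := M.V_rdiv φ ψ s

theorem Model.le_box_iff (M : Model F) {α : Act} {φ : Formula X} {s : F.S} {a : X} :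
    a ≤ M.V (.box α φ) s ↔ ∀ t, a * F.R α s t ≤ M.V φ t := by
  rw [M.V_box, le_bigMeet_himp_iff]

theorem Model.valid_of_pdlAx (hcomm : ∀ a b : X, a * b = b * a) (hint : ∀ a : X, a ≤ 1)
    (M : Model F) {φ : Formula X} (hφ : PDLAx φ) : M.Valid φ := by
  intro s
  have hs := M.isNonModalHom s
  cases hφ with
  | one α =>
    refine M.le_box_iff.2 fun t => ?_
    rw [M.V_const]
    exact hint _
  | reg α φ ψ =>
    refine hs.one_le_imp_iff.2 (M.le_box_iff.2 fun t => ?_)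
    rw [M.V_and, M.V_and]
    exact le_inf (M.le_box_iff.1 inf_le_left t) (M.le_box_iff.1 inf_le_right t)
  | const α c φ =>
    refine hs.one_le_iff_iff.2 (eq_of_forall_le_iff fun a => ?_)
    simp only [Formula.imp, M.V_rdiv, M.V_const, le_rdiv_iff, M.le_box_iff]
    refine forall_congr' fun t => ?_
    rw [mul_assoc, mul_assoc, hcomm c]
  | choice α β φ =>
    refine hs.one_le_iff_iff.2 (eq_of_forall_le_iff fun a => ?_)
    simp only [M.V_and, le_inf_iff, M.le_box_iff, F.R_choice, relUnion, mul_sup_le_iff,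
      forall_and]
  | comp α β φ =>
    refine hs.one_le_iff_iff.2 (eq_of_forall_le_iff fun a => ?_)
    simp only [M.le_box_iff, F.R_comp, relComp, mul_bigJoin_le_iff, mul_assoc]
    exact forall_comm
  | plus α φ =>
    refine hs.one_le_iff_iff.2 (eq_of_forall_le_iff fun a => ?_)
    simp only [M.le_box_iff, M.V_and, le_inf_iff, F.R_plus]
    constructor
    · intro h t
      refine ⟨(mul_mono_right a (le_relPlus _ s t)).trans (h t), fun u => ?_⟩
      rw [mul_assoc]
      exact (mul_mono_right a (mul_relPlus_le _ s t u)).trans (h u)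
    · intro h
      exact mul_relPlus_le_of_first_step (fun t => (h t).1) fun u => (h u).2

theorem Model.valid_of_pdlRule (M : Model F) {Δ : Finset (Formula X)} {φ : Formula X}
    (hr : PDLRule (Δ, φ)) (hΔ : ∀ ψ ∈ Δ, M.Valid ψ) : M.Valid φ := by
  have himp : ∀ {φ ψ : Formula X}, M.Valid (φ.imp ψ) ↔ ∀ s, M.V φ s ≤ M.V ψ s :=
    forall_congr' fun s => (M.isNonModalHom s).one_le_imp_iff
  cases hr with
  | mon α φ ψ =>
    have h := himp.1 (hΔ _ (Finset.mem_singleton_self _))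
    exact himp.2 fun s => M.le_box_iff.2 fun t => (M.le_box_iff.1 le_rfl t).trans (h t)
  | plus α φ =>
    have h := himp.1 (hΔ _ (Finset.mem_singleton_self _))
    refine himp.2 fun s => M.le_box_iff.2 fun t => ?_
    rw [F.R_plus]
    exact mul_relPlus_le_of_forall (f := M.V φ) (fun s t => M.le_box_iff.1 (h s) t) s t

theorem Model.valid_of_isTheorem (hcomm : ∀ a b : X, a * b = b * a) (hint : ∀ a : X, a ≤ 1)
    {L : HilbertSystem X} (hL : L.StronglyComplete) (M : Model F) {φ : Formula X}
    (hφ : (PDL L).IsTheorem φ) : M.Valid φ := by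
  induction hφ with
  | hyp φ h => exact h.elim
  | ax φ h =>
    rcases h with h | h
    · exact fun s => (hL ∅ φ).1 (.ax φ h) _ (M.isNonModalHom s) (by simp)
    · exact M.valid_of_pdlAx hcomm hint h
  | rule Δ φ h _ ih =>
    rcases h with h | h
    · exact fun s => (hL Δ φ).1 (.rule Δ φ h fun ψ hψ => .hyp ψ hψ) _ (M.isNonModalHom s)
        fun ψ hψ => ih ψ hψ s
    · exact M.valid_of_pdlRule h ih

end Soundness

/-! ### Canonical homomorphisms -/

section Canonical

variable {X : Type u} [FLAlgebra X]

/-- A non-modal homomorphism is canonical for `L` if it validates all theorems of `PDL(X)`. -/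
structure IsCanonical (L : HilbertSystem X) (k : Formula X → X) : Prop where
  hom : IsNonModalHom k
  one_le : ∀ φ, (PDL L).IsTheorem φ → 1 ≤ k φ

/-- The type of canonical homomorphisms. -/
abbrev CanonicalHom (L : HilbertSystem X) : Type u := {k : Formula X → X // IsCanonical L k}

variable {L : HilbertSystem X}

/-- The theorems of `PDL(X)` are closed under `Log(X)`-derivability, so strong completeness
applies with the set of all theorems as assumptions. -/
theorem isTheorem_of_canonical (hL : L.StronglyComplete) {φ : Formula X}
    (h : ∀ k : CanonicalHom L, 1 ≤ k.1 φ) : (PDL L).IsTheorem φ := by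
  have hd : L.Derivable {ψ | (PDL L).IsTheorem ψ} φ :=
    (hL _ _).2 fun k hk hT => h ⟨k, hk, hT⟩
  clear h
  induction hd with
  | hyp φ h => exact h
  | ax φ h => exact .ax φ (Or.inl h)
  | rule Δ φ h _ ih => exact .rule Δ φ (Or.inl h) ih

theorem isTheorem_imp_of_canonical (hL : L.StronglyComplete) {φ ψ : Formula X}
    (h : ∀ k : CanonicalHom L, k.1 φ ≤ k.1 ψ) : (PDL L).IsTheorem (φ.imp ψ) :=
  isTheorem_of_canonical hL fun k => k.2.hom.one_le_imp_iff.2 (h k)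

namespace CanonicalHom

theorem one_le_of_pdlAx (k : CanonicalHom L) {φ : Formula X} (h : PDLAx φ) : 1 ≤ k.1 φ :=
  k.2.one_le φ (.ax φ (Or.inr h))

theorem box_one (k : CanonicalHom L) (α : Act) : 1 ≤ k.1 (.box α (.const 1)) :=
  k.one_le_of_pdlAx (.one α)

theorem box_and (k : CanonicalHom L) (α : Act) (φ ψ : Formula X) :
    k.1 (.box α φ) ⊓ k.1 (.box α ψ) ≤ k.1 (.box α (.and φ ψ)) := by
  rw [← k.2.hom.map_and]
  exact k.2.hom.one_le_imp_iff.1 (k.one_le_of_pdlAx (.reg α φ ψ))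

theorem box_const_imp (k : CanonicalHom L) (α : Act) (c : X) (φ : Formula X) :
    k.1 (.box α (.imp (.const c) φ)) = FLAlgebra.rdiv (k.1 (.box α φ)) c := by
  rw [k.2.hom.one_le_iff_iff.1 (k.one_le_of_pdlAx (.const α c φ)), Formula.imp, k.2.hom.map_rdiv,
    k.2.hom.map_const]

theorem box_choice (k : CanonicalHom L) (α β : Act) (φ : Formula X) :
    k.1 (.box (.choice α β) φ) = k.1 (.box α φ) ⊓ k.1 (.box β φ) := by
  rw [k.2.hom.one_le_iff_iff.1 (k.one_le_of_pdlAx (.choice α β φ)), k.2.hom.map_and]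

theorem box_comp (k : CanonicalHom L) (α β : Act) (φ : Formula X) :
    k.1 (.box (.comp α β) φ) = k.1 (.box α (.box β φ)) :=
  k.2.hom.one_le_iff_iff.1 (k.one_le_of_pdlAx (.comp α β φ))

theorem box_plus (k : CanonicalHom L) (α : Act) (φ : Formula X) :
    k.1 (.box (.plus α) φ) = k.1 (.box α (.and φ (.box (.plus α) φ))) :=
  k.2.hom.one_le_iff_iff.1 (k.one_le_of_pdlAx (.plus α φ))

theorem le_box_plus (hL : L.StronglyComplete) {α : Act} {φ : Formula X}
    (h : ∀ l : CanonicalHom L, l.1 φ ≤ l.1 (.box α φ)) (k : CanonicalHom L) :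
    k.1 φ ≤ k.1 (.box (.plus α) φ) := by
  refine k.2.hom.one_le_imp_iff.1 (k.2.one_le _ (.rule _ _ (Or.inr (.plus α φ)) fun ψ hψ => ?_))
  rw [Finset.mem_singleton.1 hψ]
  exact isTheorem_imp_of_canonical hL h

/-- Monotonicity of `[α]`, with a constant factor: an instance of the monotonicity rule followed
by the axiom for `[α](c̄ → ψ)`. -/
theorem box_mul_le_box (hL : L.StronglyComplete) {φ ψ : Formula X} {c : X}
    (h : ∀ l : CanonicalHom L, l.1 φ * c ≤ l.1 ψ) (k : CanonicalHom L) (α : Act) :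
    k.1 (.box α φ) * c ≤ k.1 (.box α ψ) := by
  rw [← le_rdiv_iff, ← k.box_const_imp]
  refine k.2.hom.one_le_imp_iff.1 (k.2.one_le _ (.rule _ _ (Or.inr (.mon α _ _)) fun χ hχ => ?_))
  rw [Finset.mem_singleton.1 hχ]
  refine isTheorem_imp_of_canonical hL fun l => ?_
  rw [Formula.imp, l.2.hom.map_rdiv, l.2.hom.map_const, le_rdiv_iff]
  exact h l

/-- The conjunction `χ` of the formulas `c̄_ψ → ψ` for `ψ` in a finite set, described by its value
and by the lower bound for `[α]χ` that the axioms for constants and conjunctions give. -/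
theorem exists_conj_const_imp (hint : ∀ a : X, a ≤ 1) (α : Act) (c : Formula X → X)
    {Ψ : Set (Formula X)} (hΨ : Ψ.Finite) :
    ∃ χ : Formula X, (∀ (k : CanonicalHom L) (x : X), x ≤ k.1 χ ↔ ∀ ψ ∈ Ψ, x * c ψ ≤ k.1 ψ) ∧
      ∀ k : CanonicalHom L, (∀ ψ ∈ Ψ, c ψ ≤ k.1 (.box α ψ)) → 1 ≤ k.1 (.box α χ) := by
  induction Ψ, hΨ using Set.Finite.induction_on with
  | empty =>
    refine ⟨.const 1, fun k x => ?_, fun k _ => k.box_one α⟩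
    simp [k.2.hom.map_const, hint]
  | @insert ψ Ψ _ _ ih =>
    obtain ⟨χ, hχ, hb⟩ := ih
    refine ⟨.and (.imp (.const (c ψ)) ψ) χ, fun k x => ?_, fun k hk => ?_⟩
    · rw [k.2.hom.map_and, le_inf_iff, hχ, Formula.imp, k.2.hom.map_rdiv, k.2.hom.map_const,
        le_rdiv_iff, Set.forall_mem_insert]
    · rw [Set.forall_mem_insert] at hk
      refine le_trans (le_inf ?_ (hb k hk.2)) (k.box_and α _ _)
      rw [box_const_imp, one_le_rdiv_iff]
      exact hk.1

end CanonicalHom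

end Canonical

/-! ### Fischer–Ladner closed sets -/

section FischerLadner

variable {X : Type u}

/-- The formulas that a Fischer–Ladner closed set must contain along with a given one: the
immediate subformulas and, for `[α]φ` with `α` compound, the boxed formulas on the right of the
axiom for `α`. -/
def flChildren : Formula X → Set (Formula X)
  | .var _ => ∅
  | .const _ => ∅
  | .and φ ψ => {φ, ψ}
  | .or φ ψ => {φ, ψ}
  | .ldiv φ ψ => {φ, ψ}
  | .mul φ ψ => {φ, ψ}
  | .rdiv φ ψ => {φ, ψ}
  | .box (.atom _) φ => {φ}
  | .box (.choice α β) φ => {φ, .box α φ, .box β φ}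
  | .box (.comp α β) φ => {φ, .box α (.box β φ)}
  | .box (.plus α) φ => {φ, .box α (.and φ (.box (.plus α) φ))}

/-- Fischer–Ladner closed sets of formulas. -/
def FLClosed (Φ : Set (Formula X)) : Prop := ∀ φ ∈ Φ, flChildren φ ⊆ Φ

/-- The formulas generated from `[α]φ` by unfolding the action `α`; together with a closed set
containing `φ` they form a closed set. -/
def flBox : Act → Formula X → Set (Formula X)
  | .atom n, φ => {.box (.atom n) φ}
  | .choice α β, φ => insert (.box (.choice α β) φ) (flBox α φ ∪ flBox β φ)
  | .comp α β, φ => insert (.box (.comp α β) φ) (flBox α (.box β φ) ∪ flBox β φ)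
  | .plus α, φ =>
      insert (.box (.plus α) φ) (insert (.and φ (.box (.plus α) φ))
        (flBox α (.and φ (.box (.plus α) φ))))

theorem finite_flBox (α : Act) (φ : Formula X) : (flBox α φ).Finite := by
  induction α generalizing φ with
  | atom n => exact Set.finite_singleton _
  | choice α β ihα ihβ => exact ((ihα φ).union (ihβ φ)).insert _
  | comp α β ihα ihβ => exact ((ihα _).union (ihβ φ)).insert _
  | plus α ih => exact ((ih _).insert _).insert _

theorem box_mem_flBox (α : Act) (φ : Formula X) : .box α φ ∈ flBox α φ := by
  cases α <;> simp [flBox]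

theorem flChildren_subset_of_mem_flBox {α : Act} {φ ψ : Formula X} (h : ψ ∈ flBox α φ) :
    flChildren ψ ⊆ insert φ (flBox α φ) := by
  induction α generalizing φ ψ with
  | atom n =>
    rw [flBox, Set.mem_singleton_iff] at h
    subst h
    simp [flChildren]
  | choice α β ihα ihβ =>
    have hα := box_mem_flBox α φ
    have hβ := box_mem_flBox β φ
    rw [flBox] at h ⊢
    rcases h with rfl | h | h
    · simp only [flChildren]
      grind
    · have := ihα h
      grind
    · have := ihβ h
      grind
  | comp α β ihα ihβ =>
    have hα := box_mem_flBox α (.box β φ)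
    have hβ := box_mem_flBox β φ
    rw [flBox] at h ⊢
    rcases h with rfl | h | h
    · simp only [flChildren]
      grind
    · have := ihα h
      grind
    · have := ihβ h
      grind
  | plus α ih =>
    have hα := box_mem_flBox α (.and φ (.box (.plus α) φ))
    rw [flBox] at h ⊢
    rcases h with rfl | rfl | h
    · simp only [flChildren]
      grind
    · simp only [flChildren]
      grind
    · have := ih h
      grind

theorem FLClosed.union {Φ Ψ : Set (Formula X)} (hΦ : FLClosed Φ) (hΨ : FLClosed Ψ) :
    FLClosed (Φ ∪ Ψ) := by
  rintro φ (h | h)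
  · exact (hΦ φ h).trans Set.subset_union_left
  · exact (hΨ φ h).trans Set.subset_union_right

theorem FLClosed.insert {Φ : Set (Formula X)} (hΦ : FLClosed Φ) {φ : Formula X}
    (hφ : flChildren φ ⊆ Φ) : FLClosed (insert φ Φ) := by
  rintro ψ (rfl | h)
  · exact hφ.trans (Set.subset_insert _ _)
  · exact (hΦ ψ h).trans (Set.subset_insert _ _)

theorem exists_flClosed (φ : Formula X) :
    ∃ Φ : Set (Formula X), Φ.Finite ∧ FLClosed Φ ∧ φ ∈ Φ := by
  have binary : ∀ {φ ψ χ : Formula X}, flChildren χ = {φ, ψ} →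
      (∃ Φ : Set (Formula X), Φ.Finite ∧ FLClosed Φ ∧ φ ∈ Φ) →
      (∃ Φ : Set (Formula X), Φ.Finite ∧ FLClosed Φ ∧ ψ ∈ Φ) →
      ∃ Φ : Set (Formula X), Φ.Finite ∧ FLClosed Φ ∧ χ ∈ Φ := by
    rintro φ ψ χ h ⟨Φ, hf, hc, hm⟩ ⟨Ψ, hf', hc', hm'⟩
    refine ⟨insert χ (Φ ∪ Ψ), (hf.union hf').insert _, (hc.union hc').insert ?_,
      Set.mem_insert _ _⟩
    rw [h]
    grind
  induction φ with
  | var n => exact ⟨{.var n}, Set.finite_singleton _, by simp [FLClosed, flChildren], rfl⟩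
  | const c => exact ⟨{.const c}, Set.finite_singleton _, by simp [FLClosed, flChildren], rfl⟩
  | and φ ψ ihφ ihψ => exact binary rfl ihφ ihψ
  | or φ ψ ihφ ihψ => exact binary rfl ihφ ihψ
  | ldiv φ ψ ihφ ihψ => exact binary rfl ihφ ihψ
  | mul φ ψ ihφ ihψ => exact binary rfl ihφ ihψ
  | rdiv φ ψ ihφ ihψ => exact binary rfl ihφ ihψ
  | box α φ ih =>
    obtain ⟨Φ, hf, hc, hm⟩ := ih
    refine ⟨Φ ∪ flBox α φ, hf.union (finite_flBox α φ), ?_, Or.inr (box_mem_flBox α φ)⟩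
    rintro ψ (h | h)
    · exact (hc ψ h).trans Set.subset_union_left
    · exact (flChildren_subset_of_mem_flBox h).trans
        (Set.insert_subset (Or.inl hm) Set.subset_union_right)

theorem FLClosed.mem_of_box_mem {Φ : Set (Formula X)} (hΦ : FLClosed Φ) {α : Act}
    {φ : Formula X} (h : .box α φ ∈ Φ) : φ ∈ Φ := by
  refine hΦ _ h ?_
  cases α <;> simp [flChildren]

end FischerLadner

/-! ### Models with prescribed atoms -/

section Generated

variable {X : Type u} [FLAlgebra X] [Finite X] {S : Type v}

/-- The accessibility relations generated by those of the atomic actions. -/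
noncomputable def relOf (R : ℕ → S → S → X) : Act → S → S → X
  | .atom n => R n
  | .choice α β => relUnion (relOf R α) (relOf R β)
  | .comp α β => relComp (relOf R α) (relOf R β)
  | .plus α => relPlus (relOf R α)

/-- The frame generated by the relations of the atomic actions. -/
noncomputable def frameOf [hS : Nonempty S] (R : ℕ → S → S → X) : Frame.{u, v} X where
  S := S
  nonempty := hS
  R := relOf R
  R_choice _ _ := rfl
  R_comp _ _ := rfl
  R_plus _ := rfl

/-- The valuation of all formulas generated by the values of the variables. -/
noncomputable def eval (R : Act → S → S → X) (v : ℕ → S → X) : Formula X → S → X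
  | .var n, s => v n s
  | .const c, _ => c
  | .and φ ψ, s => eval R v φ s ⊓ eval R v ψ s
  | .or φ ψ, s => eval R v φ s ⊔ eval R v ψ s
  | .ldiv φ ψ, s => FLAlgebra.ldiv (eval R v φ s) (eval R v ψ s)
  | .mul φ ψ, s => eval R v φ s * eval R v ψ s
  | .rdiv φ ψ, s => FLAlgebra.rdiv (eval R v φ s) (eval R v ψ s)
  | .box α φ, s => bigMeet fun t : S => FLAlgebra.himp (R α s t) (eval R v φ t)

/-- The model on `frameOf R` generated by the values of the variables. -/
noncomputable def modelOf [Nonempty S] (R : ℕ → S → S → X) (v : ℕ → S → X) :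
    Model (frameOf R) where
  V := eval (relOf R) v
  V_const _ _ := rfl
  V_and _ _ _ := rfl
  V_or _ _ _ := rfl
  V_ldiv _ _ _ := rfl
  V_mul _ _ _ := rfl
  V_rdiv _ _ _ := rfl
  V_box _ _ _ := rfl

end Generated

/-! ### Filtration of the canonical homomorphisms -/

section Filtration

variable {X : Type u} [FLAlgebra X]

/-- A type `W` of classes of canonical homomorphisms, homomorphisms of the same class agreeing on
`Φ`, with a choice of representatives. -/
structure CanonicalFiltration (L : HilbertSystem X) (Φ : Set (Formula X)) (W : Type v) where
  /-- The class of a canonical homomorphism. -/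
  cl : CanonicalHom L → W
  /-- The chosen representative of a class. -/
  rep : W → CanonicalHom L
  cl_rep : ∀ w, cl (rep w) = w
  rep_cl : ∀ k, ∀ φ ∈ Φ, (rep (cl k)).1 φ = k.1 φ

theorem exists_canonicalFiltration [Finite X] (L : HilbertSystem X) {Φ : Set (Formula X)}
    (hΦ : Φ.Finite) : ∃ W : Type v, Finite W ∧ Nonempty (CanonicalFiltration L Φ W) := by
  classical
  have := hΦ.to_subtype
  let r : CanonicalHom L → Φ → X := fun k φ => k.1 φ
  -- The passage to `Fin n` moves the classes to an arbitrary universe.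
  obtain ⟨n, ⟨e⟩⟩ := Finite.exists_equiv_fin (Set.range r)
  refine ⟨ULift.{v} (Fin n), inferInstance, ⟨{
    cl := fun k => ⟨e ⟨r k, k, rfl⟩⟩
    rep := fun w => (e.symm w.down).2.choose
    cl_rep := fun w => ?_
    rep_cl := fun k φ hφ => ?_ }⟩⟩
  · have h := (e.symm w.down).2.choose_spec
    exact ULift.ext _ _ (e.eq_symm_apply.1 (Subtype.ext h))
  · have h := (e.symm (e ⟨r k, k, rfl⟩)).2.choose_spec
    rw [Equiv.symm_apply_apply] at h
    have h' := congrFun h ⟨φ, hφ⟩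
    simpa [r] using h'

namespace CanonicalFiltration

variable {L : HilbertSystem X} {Φ : Set (Formula X)} {W : Type v}

/-- A function of the class of a canonical homomorphism is definable if it is the value of a
formula. -/
def Definable (M : CanonicalFiltration L Φ W) (f : W → X) : Prop :=
  ∃ χ : Formula X, ∀ k : CanonicalHom L, k.1 χ = f (M.cl k)

variable {M : CanonicalFiltration L Φ W}

theorem Definable.mul_const {f : W → X} (hf : M.Definable f) (c : X) :
    M.Definable fun w => c * f w := by
  obtain ⟨χ, hχ⟩ := hf
  exact ⟨.mul (.const c) χ, fun k => by rw [k.2.hom.map_mul, k.2.hom.map_const, hχ]⟩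

theorem Definable.sup {f g : W → X} (hf : M.Definable f) (hg : M.Definable g) :
    M.Definable fun w => f w ⊔ g w := by
  obtain ⟨χ, hχ⟩ := hf
  obtain ⟨χ', hχ'⟩ := hg
  exact ⟨.or χ χ', fun k => by rw [k.2.hom.map_or, hχ, hχ']⟩

variable [Finite X]

/-- The relation of the atomic action `a_n`: the largest one that satisfies
`R(w, t) · w([a_n]ψ) ≤ t(ψ)` for all `[a_n]ψ` in `Φ`. -/
noncomputable def atomRel (M : CanonicalFiltration L Φ W) (n : ℕ) (w t : W) : X :=
  bigMeet fun ψ : {ψ : Formula X // .box (.atom n) ψ ∈ Φ} =>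
    FLAlgebra.rdiv ((M.rep t).1 ψ) ((M.rep w).1 (.box (.atom n) ψ))

/-- The relations of the filtration. -/
noncomputable abbrev rel (M : CanonicalFiltration L Φ W) : Act → W → W → X := relOf M.atomRel

/-- The index type is arbitrary: only finitely many functions `W → X` exist. -/
theorem Definable.bigJoin [Finite W] {ι : Type*} {f : ι → W → X} (hf : ∀ i, M.Definable (f i)) :
    M.Definable fun w => bigJoin fun i => f i w := by
  have key : ∀ A : Set (W → X), A.Finite → (∀ g ∈ A, M.Definable g) →
      ∃ χ : Formula X, ∀ (k : CanonicalHom L) (x : X), k.1 χ ≤ x ↔ ∀ g ∈ A, g (M.cl k) ≤ x := by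
    intro A hA
    induction A, hA using Set.Finite.induction_on with
    | empty =>
      obtain ⟨b, hb⟩ := exists_isLUB (∅ : Set X)
      refine fun _ => ⟨.const b, fun k x => ?_⟩
      rw [k.2.hom.map_const]
      simpa using isLUB_empty_iff.1 hb x
    | @insert g A _ _ ih =>
      intro h
      rw [Set.forall_mem_insert] at h
      obtain ⟨χ, hχ⟩ := h.1
      obtain ⟨χ', hχ'⟩ := ih h.2
      exact ⟨.or χ χ', fun k x => by
        rw [k.2.hom.map_or, sup_le_iff, hχ, hχ', Set.forall_mem_insert]⟩
  obtain ⟨χ, hχ⟩ := key (Set.range f) (Set.toFinite _) (Set.forall_mem_range.2 hf)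
  refine ⟨χ, fun k => eq_of_forall_ge_iff fun x => ?_⟩
  rw [hχ, Set.forall_mem_range, bigJoin_le_iff]

/-- The atomic relation is defined by a conjunction of formulas `c̄ → ψ`, and the box of that
conjunction holds at `k`. -/
theorem exists_formula_atomRel (hint : ∀ a : X, a ≤ 1) (M : CanonicalFiltration L Φ W)
    (hΦ : FLClosed Φ) (hfin : Φ.Finite) (n : ℕ) (k : CanonicalHom L) :
    ∃ χ : Formula X, (∀ l : CanonicalHom L, l.1 χ = M.atomRel n (M.cl k) (M.cl l)) ∧
      1 ≤ k.1 (.box (.atom n) χ) := by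
  have hΨ : {ψ : Formula X | .box (.atom n) ψ ∈ Φ}.Finite :=
    hfin.subset fun ψ hψ => hΦ.mem_of_box_mem hψ
  obtain ⟨χ, hχ, hb⟩ := CanonicalHom.exists_conj_const_imp (L := L) hint (.atom n)
    (fun ψ => k.1 (.box (.atom n) ψ)) hΨ
  refine ⟨χ, fun l => eq_of_forall_le_iff fun x => ?_, hb k fun _ _ => le_rfl⟩
  rw [hχ, atomRel, le_bigMeet_iff, Subtype.forall]
  refine forall₂_congr fun ψ hψ => ?_
  rw [le_rdiv_iff, M.rep_cl k _ hψ, M.rep_cl l _ (hΦ.mem_of_box_mem hψ)]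

theorem definable_rel [Finite W] (hint : ∀ a : X, a ≤ 1) (M : CanonicalFiltration L Φ W)
    (hΦ : FLClosed Φ) (hfin : Φ.Finite) (α : Act) (w : W) : M.Definable (M.rel α w) := by
  induction α generalizing w with
  | atom n =>
    obtain ⟨χ, hχ, -⟩ := M.exists_formula_atomRel hint hΦ hfin n (M.rep w)
    rw [M.cl_rep] at hχ
    exact ⟨χ, hχ⟩
  | choice α β ihα ihβ => exact (ihα w).sup (ihβ w)
  | comp α β ihα ihβ => exact .bigJoin fun x => (ihβ x).mul_const _
  | plus α ih =>
    refine .bigJoin (f := fun π t => pathValue (M.rel α) w π t) fun π => ?_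
    cases π with
    | nil => exact ih w
    | cons u π => exact (ih u).mul_const _

/-- The lower bound for boxes. For `α⁺`, the induction rule is applied to a formula whose value at
`t` is `R_{α⁺}(w, t)`. -/
theorem le_box_of_mul_rel_le [Finite W] (hcomm : ∀ a b : X, a * b = b * a)
    (hint : ∀ a : X, a ≤ 1) (hL : L.StronglyComplete) (M : CanonicalFiltration L Φ W)
    (hΦ : FLClosed Φ) (hfin : Φ.Finite) (α : Act) (k : CanonicalHom L) (φ : Formula X) (c : X)
    (h : ∀ l : CanonicalHom L, c * M.rel α (M.cl k) (M.cl l) ≤ l.1 φ) :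
    c ≤ k.1 (.box α φ) := by
  induction α generalizing k φ c with
  | atom n =>
    obtain ⟨χ, hχ, hk⟩ := M.exists_formula_atomRel hint hΦ hfin n k
    have hmono := CanonicalHom.box_mul_le_box hL (φ := χ) (ψ := φ) (c := c)
      (fun l => by rw [hχ, hcomm]; exact h l) k (.atom n)
    calc c = 1 * c := (one_mul c).symm
      _ ≤ k.1 (.box (.atom n) χ) * c := mul_mono_left c hk
      _ ≤ _ := hmono
  | choice α β ihα ihβ =>
    have h' := fun l => mul_sup_le_iff.1 (h l)
    rw [k.box_choice]
    exact le_inf (ihα k φ c fun l => (h' l).1) (ihβ k φ c fun l => (h' l).2)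
  | comp α β ihα ihβ =>
    rw [k.box_comp]
    refine ihα k _ c fun l => ihβ l _ _ fun m => ?_
    rw [mul_assoc]
    exact mul_bigJoin_le_iff.1 (h m) (M.cl l)
  | plus α ih =>
    obtain ⟨χ, hχ⟩ := M.definable_rel hint hΦ hfin (.plus α) (M.cl k)
    have hχ_box : ∀ l : CanonicalHom L, l.1 χ ≤ l.1 (.box (.plus α) χ) := by
      refine CanonicalHom.le_box_plus hL fun l => ih l _ _ fun m => ?_
      rw [hχ, hχ]
      exact relPlus_mul_le _ _ _ _
    have hk : 1 ≤ k.1 (.box (.plus α) χ) := by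
      rw [k.box_plus]
      refine ih k _ 1 fun l => ?_
      rw [one_mul, l.2.hom.map_and]
      refine (le_relPlus _ _ _).trans ?_
      exact (hχ l).symm.le.trans (le_inf le_rfl (hχ_box l))
    have hmono := CanonicalHom.box_mul_le_box hL (φ := χ) (ψ := φ) (c := c)
      (fun l => by rw [hχ, hcomm]; exact h l) k (.plus α)
    calc c = 1 * c := (one_mul c).symm
      _ ≤ k.1 (.box (.plus α) χ) * c := mul_mono_left c hk
      _ ≤ _ := hmono

/-- The upper bound for boxes. -/
theorem box_mul_rel_le (hcomm : ∀ a b : X, a * b = b * a) (M : CanonicalFiltration L Φ W)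
    (hΦ : FLClosed Φ) {α : Act} {φ : Formula X} (h : .box α φ ∈ Φ) (w t : W) :
    (M.rep w).1 (.box α φ) * M.rel α w t ≤ (M.rep t).1 φ := by
  induction α generalizing φ w t with
  | atom n =>
    rw [hcomm, ← le_rdiv_iff]
    exact bigMeet_le (fun ψ : {ψ : Formula X // .box (.atom n) ψ ∈ Φ} =>
      FLAlgebra.rdiv ((M.rep t).1 ψ) ((M.rep w).1 (.box (.atom n) ψ))) ⟨φ, h⟩
  | choice α β ihα ihβ =>
    have hα : .box α φ ∈ Φ := hΦ _ h (by simp [flChildren])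
    have hβ : .box β φ ∈ Φ := hΦ _ h (by simp [flChildren])
    rw [CanonicalHom.box_choice]
    exact mul_sup_le_iff.2 ⟨(mul_mono_left _ inf_le_left).trans (ihα hα w t),
      (mul_mono_left _ inf_le_right).trans (ihβ hβ w t)⟩
  | comp α β ihα ihβ =>
    have hα : .box α (.box β φ) ∈ Φ := hΦ _ h (by simp [flChildren])
    rw [CanonicalHom.box_comp]
    refine mul_bigJoin_le_iff.2 fun x => ?_
    rw [← mul_assoc]
    exact (mul_mono_left _ (ihα hα w x)).trans (ihβ (hΦ.mem_of_box_mem hα) x t)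
  | plus α ih =>
    have hα : .box α (.and φ (.box (.plus α) φ)) ∈ Φ := hΦ _ h (by simp [flChildren])
    have step : ∀ s t, (M.rep s).1 (.box (.plus α) φ) * M.rel α s t ≤
        (M.rep t).1 φ ⊓ (M.rep t).1 (.box (.plus α) φ) := fun s t => by
      rw [← (M.rep t).2.hom.map_and, CanonicalHom.box_plus]
      exact ih hα s t
    -- `[α⁺]φ` is preserved along `R_α`, and gives `φ` after the last step of a path.
    have invariant := mul_relPlus_le_of_forall (f := fun s => (M.rep s).1 (.box (.plus α) φ))
      fun s t => (step s t).trans inf_le_right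
    refine mul_bigJoin_le_iff.2 fun π => ?_
    cases π with
    | nil => exact (step w t).trans inf_le_left
    | cons u π =>
      rw [pathValue, ← mul_assoc]
      refine (mul_mono_left _ ?_).trans ((step u t).trans inf_le_left)
      exact (mul_mono_right _ (le_bigJoin (fun π => pathValue (M.rel α) w π u) π)).trans
        (invariant w u)

/-- The truth lemma. -/
theorem eval_eq [Finite W] (hcomm : ∀ a b : X, a * b = b * a)
    (hint : ∀ a : X, a ≤ 1) (hL : L.StronglyComplete) (M : CanonicalFiltration L Φ W)
    (hΦ : FLClosed Φ) (hfin : Φ.Finite) {φ : Formula X} (h : φ ∈ Φ) (w : W) :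
    eval M.rel (fun n w => (M.rep w).1 (.var n)) φ w = (M.rep w).1 φ := by
  have hw := (M.rep w).2.hom
  induction φ generalizing w with
  | var n => rfl
  | const c => exact (hw.map_const c).symm
  | and φ ψ ihφ ihψ =>
    rw [eval, hw.map_and, ihφ (hΦ _ h (by simp [flChildren])) w hw,
      ihψ (hΦ _ h (by simp [flChildren])) w hw]
  | or φ ψ ihφ ihψ =>
    rw [eval, hw.map_or, ihφ (hΦ _ h (by simp [flChildren])) w hw,
      ihψ (hΦ _ h (by simp [flChildren])) w hw]
  | ldiv φ ψ ihφ ihψ =>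
    rw [eval, hw.map_ldiv, ihφ (hΦ _ h (by simp [flChildren])) w hw,
      ihψ (hΦ _ h (by simp [flChildren])) w hw]
  | mul φ ψ ihφ ihψ =>
    rw [eval, hw.map_mul, ihφ (hΦ _ h (by simp [flChildren])) w hw,
      ihψ (hΦ _ h (by simp [flChildren])) w hw]
  | rdiv φ ψ ihφ ihψ =>
    rw [eval, hw.map_rdiv, ihφ (hΦ _ h (by simp [flChildren])) w hw,
      ihψ (hΦ _ h (by simp [flChildren])) w hw]
  | box α φ ih =>
    have hφ := hΦ.mem_of_box_mem h
    have ih' := fun t => ih hφ t (M.rep t).2.hom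
    simp only [eval, ih']
    refine le_antisymm ?_ (le_bigMeet_himp_iff.2 fun t => M.box_mul_rel_le hcomm hΦ h w t)
    refine M.le_box_of_mul_rel_le hcomm hint hL hΦ hfin α (M.rep w) φ _ fun l => ?_
    rw [M.cl_rep, ← M.rep_cl l φ hφ]
    exact le_bigMeet_himp_iff.1 le_rfl (M.cl l)

end CanonicalFiltration

end Filtration

end FLPDL

open FLPDL in
theorem theorem5p2 {X : Type u} [FLPDL.FLAlgebra X] [Finite X]
    (hcomm : ∀ a b : X, a * b = b * a) (hint : ∀ a : X, a ≤ 1)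
    (L : FLPDL.HilbertSystem X) (hL : L.StronglyComplete) (φ : FLPDL.Formula X) :
    (∀ F : FLPDL.Frame.{u, v} X, F.Valid φ) ↔ (FLPDL.PDL L).IsTheorem φ := by
  refine ⟨fun hv => isTheorem_of_canonical hL fun k => ?_,
    fun hφ F M => M.valid_of_isTheorem hcomm hint hL hφ⟩
  obtain ⟨Φ, hfin, hΦ, hmem⟩ := exists_flClosed φ
  obtain ⟨W, _, ⟨M⟩⟩ := exists_canonicalFiltration.{u, v} L hfin
  have : Nonempty W := ⟨M.cl k⟩
  have h := hv (frameOf M.atomRel) (modelOf M.atomRel fun n w => (M.rep w).1 (.var n)) (M.cl k)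
  rw [← M.rep_cl k φ hmem, ← M.eval_eq hcomm hint hL hΦ hfin hmem]
  exact h
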